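/- **Theorem 1.** Let $D\subset\mathbb{R}^d$ be compact and convex, and let $k:D\times D\to\mathbb{R}$ be a kernel such that $f\sim\mathcal{GP}(0,k)$ is not almost surely constant on $D$, i.e. $\mathrm{Var}(f(x)-f(y))=k(x,x)-2k(x,y)+k(y,y)\neq 0$ for some $x,y\in D$. Suppose that $f\sim\mathcal{GP}(0,k)$ is almost surely twice continuously differentiable on $D$ and that for some constants $a_i$ and $b_i>0$ ($i=1,2$) and all $L\ge 0$, $$\Pr\Big(\sup_{x\in D}\Big|\frac{\partial f}{\partial x^{(j)}}(x)\Big|>L\Big)\le a_1e^{-(L/b_1)^2},\qquad \Pr\Big(\sup_{x\in D}\Big|\frac{\partial^2 f}{\partial x^{(j_1)}\partial x^{(j_2)}}(x)\Big|>L\Big)\le a_2e^{-(L/b_2)^2}$$ for all $j,j_1,j_2\in\{1,\dots,d\}$ (derivatives at boundary points being taken within $D$). Let $g_1,g_2,\dots$ be independent samples of $\mathcal{GP}(0,k)$ with these properties, and for $\epsilon\in[0,1]$ let $$f_1=g_1,\qquad f_{t+1}=\sqrt{1-\epsilon}\,f_t+\sqrt{\epsilon}\,g_{t+1}\quad(t\ge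 1).$$ A bandit algorithm chooses $x_t\in D$ as a measurable function of an independent random seed and of $(x_i,y_i)_{i<t}$, where $y_i=f_i(x_i)+z_i$ and the noise variables $z_i\sim\mathcal N(0,\sigma^2)$ are independent of each other, of $(g_i)_i$ and of the seed. A full-information algorithm chooses $x_t\in D$ as a measurable function of an independent random seed and of the entire functions $f_1,\dots,f_{t-1}$. Let $R_T=\sum_{t=1}^T\big(\max_{x\in D}f_t(x)-f_t(x_t)\big)$. Then $\mathbb{E}[R_T]=\Omega(T\epsilon)$ for every algorithm: there is a constant $c>0$, which does not depend on $\epsilon$, $T$, $\sigma$ or the algorithm, such that for all $\epsilon\in[0,1]$, all $\sigma \ge 0$ and all $T$, every bandit algorithm (which may depend on $k$, $\epsilon$, $\sigma$, $T$) has integrable $R_T$ with $$\mathbb{E}[R_T]\ge c\,T\epsilon ,$$ and the same holds, with the same $c$, for every full-information algorithm. -/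

import Mathlib

open MeasureTheory ProbabilityTheory
open scoped NNReal ENNReal

universe u v

namespace TVGP

/-- Points of `ℝ^d`, with the Euclidean norm. -/
abbrev Pt (d : ℕ) : Type := EuclideanSpace ℝ (Fin d)

noncomputable section

/-- The partial derivative `∂f/∂x^(j)` at `x`, taken within the domain `D` (at interior points it is
the ordinary one; when `D` is convex with nonempty interior it is uniquely determined on all of
`D`). -/
def partialDeriv {d : ℕ} (D : Set (Pt d)) (j : Fin d) (f : Pt d → ℝ) (x : Pt d) : ℝ :=
  fderivWithin ℝ f D x (EuclideanSpace.single j 1)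

/-- The random function `f` on `D` is a sample from `GP(0, k)`. Only the values of `f ω` and `k` on
`D` matter. -/
structure IsGPSample {d : ℕ} (D : Set (Pt d)) (k : Pt d → Pt d → ℝ)
    {Ω : Type u} [MeasurableSpace Ω] (P : Measure Ω) (f : Ω → Pt d → ℝ) : Prop where
  measurable : Measurable (fun ω ↦ D.domRestrict (f ω))
  gaussian : IsGaussianProcess (fun (x : D) (ω : Ω) ↦ f ω x) P
  mean_eq_zero : ∀ x ∈ D, ∫ ω, f ω x ∂P = 0
  covariance_eq : ∀ x ∈ D, ∀ y ∈ D,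
    covariance (fun ω ↦ f ω x) (fun ω ↦ f ω y) P = k x y

/-- The random function `f` is almost surely twice continuously differentiable on `D`, and the
suprema over `D` of its first and second partial derivatives have sub-Gaussian tails with constants
`(a₁, b₁)` and `(a₂, b₂)`. The event `sup_{x ∈ D} |h x| > L` is written `∃ x ∈ D, L < |h x|`. -/
structure SmoothSample {d : ℕ} (D : Set (Pt d)) (a₁ b₁ a₂ b₂ : ℝ)
    {Ω : Type u} [MeasurableSpace Ω] (P : Measure Ω) (f : Ω → Pt d → ℝ) : Prop where
  contDiffOn : ∀ᵐ ω ∂P, ContDiffOn ℝ 2 (f ω) D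
  tail_first : ∀ (j : Fin d) (L : ℝ), 0 ≤ L →
    P {ω | ∃ x ∈ D, L < |partialDeriv D j (f ω) x|}
      ≤ ENNReal.ofReal (a₁ * Real.exp (-(L / b₁) ^ 2))
  tail_second : ∀ (j₁ j₂ : Fin d) (L : ℝ), 0 ≤ L →
    P {ω | ∃ x ∈ D, L < |partialDeriv D j₁ (partialDeriv D j₂ (f ω)) x|}
      ≤ ENNReal.ofReal (a₂ * Real.exp (-(L / b₂) ^ 2))

/-- The reward functions built from the innovations `g 0, g 1, …`. Time starts at `0`. -/
def reward {d : ℕ} (ε : ℝ) (g : ℕ → Pt d → ℝ) : ℕ → Pt d → ℝ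
  | 0 => g 0
  | t + 1 => fun x ↦ Real.sqrt (1 - ε) * reward ε g t x + Real.sqrt ε * g (t + 1) x

/-- A (possibly randomized) bandit algorithm: the query at time `t` is a measurable function of a
private random seed in `S` and of the earlier queries with their noisy observations. -/
structure BanditAlgorithm {d : ℕ} (D : Set (Pt d)) (S : Type v) [MeasurableSpace S] where
  query : (t : ℕ) → S × (Fin t → D × ℝ) → D
  measurable_query : ∀ t, Measurable (query t)

/-- The queries `x_t` made by a bandit algorithm with seed `s`, for rewards `f` and noise `z`:
the observation at time `i` is `y_i = f_i(x_i) + z_i`. -/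
def BanditAlgorithm.play {d : ℕ} {D : Set (Pt d)} {S : Type v} [MeasurableSpace S]
    (A : BanditAlgorithm D S) (s : S) (f : ℕ → Pt d → ℝ) (z : ℕ → ℝ) (t : ℕ) : D :=
  A.query t (s, fun i : Fin t ↦ (A.play s f z i, f i (A.play s f z i) + z i))
termination_by t
decreasing_by all_goals exact i.isLt

/-- A (possibly randomized) full-information algorithm: the query at time `t` is a measurable
function of a private random seed in `S` and of the entire earlier reward functions. -/
structure FullInfoAlgorithm {d : ℕ} (D : Set (Pt d)) (S : Type v) [MeasurableSpace S] where
  query : (t : ℕ) → S × (Fin t → (D → ℝ)) → D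
  measurable_query : ∀ t, Measurable (query t)

/-- The queries made by a full-information algorithm with seed `s`, for rewards `f`. -/
def FullInfoAlgorithm.play {d : ℕ} {D : Set (Pt d)} {S : Type v} [MeasurableSpace S]
    (A : FullInfoAlgorithm D S) (s : S) (f : ℕ → Pt d → ℝ) (t : ℕ) : D :=
  A.query t (s, fun i : Fin t ↦ D.domRestrict (f i))

/-- The cumulative regret `R_T`, the sum over the first `T` time steps of
`max_{y ∈ D} f_t(y) - f_t(x_t)`. -/
def cumRegret {d : ℕ} (D : Set (Pt d)) (f : ℕ → Pt d → ℝ) (x : ℕ → D) (T : ℕ) : ℝ :=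
  ∑ t ∈ Finset.range T, ((⨆ y : D, f t y) - f t (x t))

/-- The randomness of the time-varying problem: independent innovations `g i ∼ GP(0, k)`,
independent noise `z t ∼ N(0, σ²)`, and the seed `U` of the algorithm, the three being mutually
independent. -/
structure IsModel {d : ℕ} (D : Set (Pt d)) (k : Pt d → Pt d → ℝ) (σ : ℝ≥0)
    {Ω : Type u} [MeasurableSpace Ω] (P : Measure Ω)
    {S : Type v} [MeasurableSpace S]
    (g : ℕ → Ω → Pt d → ℝ) (z : ℕ → Ω → ℝ) (U : Ω → S) : Prop where
  gp : ∀ i, IsGPSample D k P (g i)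
  indep_g : iIndepFun (fun i ω ↦ D.domRestrict (g i ω)) P
  measurable_z : ∀ t, Measurable (z t)
  law_z : ∀ t, P.map (z t) = gaussianReal 0 (σ ^ 2)
  indep_z : iIndepFun z P
  measurable_U : Measurable U
  indep_g_z : IndepFun (fun ω i ↦ D.domRestrict (g i ω)) (fun ω t ↦ z t ω) P
  indep_U : IndepFun U
    (fun ω ↦ ((fun i ↦ D.domRestrict (g i ω) : ℕ → D → ℝ), (fun t ↦ z t ω : ℕ → ℝ))) P

end

end TVGP

/-! The query at time `t + 1` depends only on the seed, the noise and the innovations up to time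
`t`, so it is independent of the fresh innovation `g (t + 1)`, whose expected value there is zero.
Hence E f_{t+1}(x_{t+1}) = √(1-ε) E f_t(x_{t+1}) ≤ √(1-ε) E max f_t. The recursion preserves the law
GP(0, k), so E max f_t = M for all t, and each step loses at least (1 - √(1-ε)) M ≥ (ε/2) M. Finally
M ≥ E max(f(x), f(y)) = E|f(x) - f(y)|/2, which is positive and depends only on k when the increment
is nondegenerate.

The analytic content is in making this rigorous: an integrable envelope from the gradient tails
(`SmoothSample.isDominated`), evaluation of a random function at an independent random point
(`integral_eval_eq_zero`), independence of past and innovation (`IsModel.indep_past`), and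
measurability of the queries up to null sets (`BanditAlgorithm.exists_measurable_play`). The
one-step loss is `IsModel.integral_reward_eval_le`. -/

namespace TVGP

/-! ### Laws of centred Gaussian processes and of their increments. -/

section Laws

variable {d : ℕ} {D : Set (Pt d)} {k : Pt d → Pt d → ℝ} {Ω : Type u} [MeasurableSpace Ω]
  {P : Measure Ω} {f g : Ω → Pt d → ℝ}

theorem IsGPSample.measurable_eval (hf : IsGPSample D k P f) (x : D) :
    Measurable (fun ω ↦ f ω x) :=
  (measurable_pi_apply x).comp hf.measurable

theorem IsGPSample.memLp_two (hf : IsGPSample D k P f) (x : D) :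
    MemLp (fun ω ↦ f ω x) 2 P :=
  (hf.gaussian.hasGaussianLaw_eval x).memLp_two

theorem IsGPSample.integrable_eval (hf : IsGPSample D k P f) (x : D) :
    Integrable (fun ω ↦ f ω x) P :=
  (hf.gaussian.hasGaussianLaw_eval x).integrable

theorem strongDual_restrict (I : Finset D) [DecidableEq I] (L : StrongDual ℝ (I → ℝ))
    (h : D → ℝ) : L (I.restrict h) = ∑ i : I, L (Pi.single i 1) * h i := by
  conv_lhs => rw [← Finset.univ_sum_single (I.restrict h), map_sum]
  refine Finset.sum_congr rfl fun i _ ↦ ?_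
  have : (Pi.single i (I.restrict h i) : I → ℝ) = h i • Pi.single i (1 : ℝ) := by
    rw [← Pi.single_smul]; simp
  rw [this, map_smul, smul_eq_mul, mul_comm]

theorem IsGPSample.integral_strongDual (hf : IsGPSample D k P f) (I : Finset D)
    (L : StrongDual ℝ (I → ℝ)) :
    ∫ ω, L (I.restrict (fun x : D ↦ f ω x)) ∂P = 0 := by
  classical
  have hi : ∀ i : I, Integrable (fun ω ↦ L (Pi.single i 1) * f ω (i : D)) P :=
    fun i ↦ (hf.integrable_eval i).const_mul _
  simp_rw [strongDual_restrict]
  rw [integral_finsetSum _ fun i _ ↦ hi i]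
  refine Finset.sum_eq_zero fun i _ ↦ ?_
  rw [integral_const_mul, hf.mean_eq_zero _ i.1.2, mul_zero]

theorem IsGPSample.variance_strongDual [IsProbabilityMeasure P] (hf : IsGPSample D k P f)
    (I : Finset D) (L : StrongDual ℝ (I → ℝ)) [DecidableEq I] :
    Var[fun ω ↦ L (I.restrict (fun x : D ↦ f ω x)); P]
      = ∑ i : I, ∑ j : I, L (Pi.single i 1) * (L (Pi.single j 1) * k (i : D) (j : D)) := by
  have hm : ∀ i : I, MemLp (fun ω ↦ L (Pi.single i 1) * f ω (i : D)) 2 P :=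
    fun i ↦ (hf.memLp_two i).const_mul _
  have hs := Finset.aemeasurable_fun_sum Finset.univ fun (i : I) _ ↦ (hm i).aemeasurable
  simp_rw [strongDual_restrict]
  rw [← covariance_self hs, covariance_fun_sum_fun_sum hm hm]
  refine Finset.sum_congr rfl fun i _ ↦ Finset.sum_congr rfl fun j _ ↦ ?_
  rw [covariance_const_mul_left, covariance_const_mul_right, hf.covariance_eq _ i.1.2 _ j.1.2]

/-- Two samples of the same centred Gaussian process have the same law. -/
theorem IsGPSample.identDistrib [IsProbabilityMeasure P] (hf : IsGPSample D k P f)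
    (hg : IsGPSample D k P g) :
    IdentDistrib (fun ω ↦ D.domRestrict (f ω)) (fun ω ↦ D.domRestrict (g ω)) P P := by
  classical
  have key := (map_eq_iff_forall_finset_map_restrict_eq (P := P) (X := fun (x : D) ω ↦ f ω x)
    (Y := fun (x : D) ω ↦ g ω x) hf.measurable.aemeasurable hg.measurable.aemeasurable).2 ?_
  · exact ⟨hf.measurable.aemeasurable, hg.measurable.aemeasurable, key⟩
  intro I
  have hF := hf.gaussian.hasGaussianLaw I
  have hG := hg.gaussian.hasGaussianLaw I
  have := hF.isGaussian_map
  have := hG.isGaussian_map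
  -- A Gaussian law is determined by the mean and variance of every linear functional; here these
  -- are zero and a quadratic form in `k`.
  refine Measure.ext_of_charFunDual (funext fun L ↦ ?_)
  rw [hF.charFunDual_map_eq_fun, hG.charFunDual_map_eq_fun, hf.integral_strongDual,
    hg.integral_strongDual, hf.variance_strongDual, hg.variance_strongDual]

/-- The law of a centred Gaussian process is stable under normalized combinations of independent
samples. -/
theorem IsGPSample.combine [IsProbabilityMeasure P] (hf : IsGPSample D k P f)
    (hg : IsGPSample D k P g)
    (hfg : IndepFun (fun ω ↦ D.domRestrict (f ω)) (fun ω ↦ D.domRestrict (g ω)) P)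
    {a b : ℝ} (hab : a ^ 2 + b ^ 2 = 1) :
    IsGPSample D k P (fun ω x ↦ a * f ω x + b * g ω x) where
  measurable := by
    refine measurable_pi_lambda _ fun x ↦ ?_
    exact ((hf.measurable_eval x).const_mul a).add ((hg.measurable_eval x).const_mul b)
  gaussian := by
    refine ⟨fun I ↦ ?_⟩
    have hF := (hf.gaussian.hasGaussianLaw I).fun_smul a
    have hG := (hg.gaussian.hasGaussianLaw I).fun_smul b
    have hm : ∀ c : ℝ, Measurable (fun h : D → ℝ ↦ c • I.restrict h) := fun c ↦
      (Finset.measurable_restrict I).const_smul c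
    exact iIndepFun.hasGaussianLaw_fun_add hF hG (hfg.comp (hm a) (hm b))
  mean_eq_zero x hx := by
    rw [integral_add ((hf.integrable_eval ⟨x, hx⟩).const_mul a)
      ((hg.integrable_eval ⟨x, hx⟩).const_mul b), integral_const_mul, integral_const_mul,
      hf.mean_eq_zero x hx, hg.mean_eq_zero x hx]
    simp
  covariance_eq x hx y hy := by
    have hfx := hf.memLp_two ⟨x, hx⟩
    have hfy := hf.memLp_two ⟨y, hy⟩
    have hgx := hg.memLp_two ⟨x, hx⟩
    have hgy := hg.memLp_two ⟨y, hy⟩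
    have h0 : ∀ x : D, ∀ y : D, cov[fun ω ↦ f ω x, fun ω ↦ g ω y; P] = 0 := fun x y ↦
      (hfg.comp (measurable_pi_apply x) (measurable_pi_apply y)).covariance_eq_zero
        (hf.memLp_two x) (hg.memLp_two y)
    have h1 := h0 ⟨x, hx⟩ ⟨y, hy⟩
    have h2 := h0 ⟨y, hy⟩ ⟨x, hx⟩
    rw [covariance_comm] at h2
    simp only at hfx hfy hgx hgy h1 h2
    have hadd := covariance_add_left (hfx.const_mul a) (hgx.const_mul b)
      ((hfy.const_mul a).add (hgy.const_mul b))
    rw [covariance_add_right (hfx.const_mul a) (hfy.const_mul a) (hgy.const_mul b),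
      covariance_add_right (hgx.const_mul b) (hfy.const_mul a) (hgy.const_mul b)] at hadd
    refine hadd.trans ?_
    simp only [covariance_const_mul_left, covariance_const_mul_right, h1, h2,
      hf.covariance_eq x hx y hy, hg.covariance_eq x hx y hy]
    linear_combination k x y * hab

theorem IsGPSample.map_sub [IsProbabilityMeasure P] (hf : IsGPSample D k P f) (x y : D) :
    P.map (fun ω ↦ f ω x - f ω y) = gaussianReal 0 (k x x - 2 * k x y + k y y).toNNReal := by
  have hx := hf.memLp_two x
  have hy := hf.memLp_two y
  have h := hf.gaussian.hasGaussianLaw_fun_sub (s := x) (t := y)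
  rw [h.map_eq_gaussianReal, integral_sub (hf.integrable_eval x) (hf.integrable_eval y),
    hf.mean_eq_zero _ x.2, hf.mean_eq_zero _ y.2, variance_fun_sub hx hy,
    ← covariance_self hx.aemeasurable, ← covariance_self hy.aemeasurable,
    hf.covariance_eq _ x.2 _ x.2, hf.covariance_eq _ y.2 _ y.2, hf.covariance_eq _ x.2 _ y.2,
    sub_zero]

theorem IsGPSample.increment_nonneg [IsProbabilityMeasure P] (hf : IsGPSample D k P f) (x y : D) :
    0 ≤ k x x - 2 * k x y + k y y := by
  have hx := hf.memLp_two x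
  have hy := hf.memLp_two y
  have h := variance_nonneg (fun ω ↦ f ω x - f ω y) P
  rwa [variance_fun_sub hx hy,
    ← covariance_self hx.aemeasurable, ← covariance_self hy.aemeasurable,
    hf.covariance_eq _ x.2 _ x.2, hf.covariance_eq _ y.2 _ y.2, hf.covariance_eq _ x.2 _ y.2] at h

/-- A nondegenerate Gaussian has no atom at zero. This makes the final constant positive. -/
theorem integral_abs_gaussianReal_pos {v : ℝ≥0} (hv : v ≠ 0) :
    0 < ∫ t, |t| ∂(gaussianReal 0 v) := by
  have hi : Integrable (fun t : ℝ ↦ |t|) (gaussianReal 0 v) :=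
    (memLp_one_iff_integrable.1 (memLp_id_gaussianReal 1)).abs
  refine (integral_pos_iff_support_of_nonneg (fun t ↦ abs_nonneg t) hi).2 ?_
  have hs : Function.support (fun t : ℝ ↦ |t|) = {0}ᶜ := by ext; simp
  have := nullSingletonClass_gaussianReal (μ := 0) hv
  rw [hs, measure_compl (measurableSet_singleton _) (measure_ne_top _ _), measure_singleton]
  simp

end Laws

/-! ### Evaluating a random function at a random point. -/

section Evaluation

open Filter Topology

/-- Separates point from function: evaluation at a simple random point becomes a finite sum of
products, to which independence applies termwise. -/
theorem simpleFunc_eval_eq_sum {K : Type*} [MeasurableSpace K] (s : SimpleFunc K K)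
    (h : K → ℝ) (p : K) :
    h (s p) = ∑ q ∈ s.range, (s ⁻¹' {q}).indicator 1 p * h q := by
  classical
  rw [Finset.sum_eq_single (s p)]
  · simp
  · intro q _ hq
    simp [hq.symm]
  · intro hp
    exact absurd (s.mem_range_self p) hp

theorem iSup_eq_iSup_denseSeq {K : Type*} [PseudoMetricSpace K] [Nonempty K]
    [CompactSpace K] {h : K → ℝ} (hc : Continuous h) :
    ⨆ y, h y = ⨆ n, h (TopologicalSpace.denseSeq K n) := by
  have hbdd : BddAbove (Set.range h) := isCompact_range hc |>.bddAbove
  refine le_antisymm (ciSup_le fun y ↦ ?_) (ciSup_le fun n ↦ le_ciSup hbdd _)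
  have hbdd' : BddAbove (Set.range fun n ↦ h (TopologicalSpace.denseSeq K n)) :=
    hbdd.mono (Set.range_comp_subset_range _ _)
  exact (TopologicalSpace.denseRange_denseSeq K).induction_on
    (p := fun y ↦ h y ≤ ⨆ n, h (TopologicalSpace.denseSeq K n)) y
    (isClosed_le hc continuous_const) (fun n ↦ le_ciSup hbdd' n)

variable {K : Type*} [PseudoMetricSpace K] [Nonempty K] [CompactSpace K] [MeasurableSpace K]
  [BorelSpace K] {Ω : Type*} [MeasurableSpace Ω]

theorem tendsto_nearestPt_denseSeq (p : K) :
    Tendsto (fun n ↦ SimpleFunc.nearestPt (TopologicalSpace.denseSeq K) n p) atTop (𝓝 p) :=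
  SimpleFunc.tendsto_nearestPt (by
    rw [(TopologicalSpace.denseRange_denseSeq K).closure_range]; trivial)

/-- Evaluation of a measurable family at a measurable point has a measurable version. -/
theorem exists_measurable_eval {x : Ω → K} (hx : Measurable x) {F : Ω → K → ℝ}
    (hF : ∀ q, Measurable (fun ω ↦ F ω q)) :
    ∃ y : Ω → ℝ, Measurable y ∧ ∀ ω, Continuous (F ω) → y ω = F ω (x ω) := by
  -- The limsup is measurable on all of `Ω`; it is the true value where the path is continuous and
  -- irrelevant elsewhere.
  refine ⟨fun ω ↦ limsup (fun n ↦
    F ω (SimpleFunc.nearestPt (TopologicalSpace.denseSeq K) n (x ω))) atTop,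
    Measurable.limsup fun n ↦ ?_, fun ω hω ↦ ?_⟩
  · simp_rw [simpleFunc_eval_eq_sum]
    refine Finset.measurable_fun_sum _ fun q _ ↦ Measurable.mul ?_ (hF q)
    exact (measurable_one.indicator (SimpleFunc.measurableSet_fiber _ q)).comp hx
  · exact ((hω.tendsto _).comp (tendsto_nearestPt_denseSeq (x ω))).limsup_eq

theorem aemeasurable_eval {P : Measure Ω} {x : Ω → K} (hx : Measurable x) {F : Ω → K → ℝ}
    (hF : ∀ q, Measurable (fun ω ↦ F ω q)) (hc : ∀ᵐ ω ∂P, Continuous (F ω)) :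
    AEMeasurable (fun ω ↦ F ω (x ω)) P := by
  obtain ⟨y, hy, hyF⟩ := exists_measurable_eval hx hF
  exact ⟨y, hy, hc.mono fun ω hω ↦ (hyF ω hω).symm⟩

/-- A centred random function, evaluated at an independent random point, is centred. -/
theorem integral_eval_eq_zero {P : Measure Ω} [IsProbabilityMeasure P] {x : Ω → K}
    (hx : Measurable x) {F : Ω → K → ℝ} (hF : Measurable F)
    (hind : IndepFun x F P) (hc : ∀ᵐ ω ∂P, Continuous (F ω)) {h : Ω → ℝ} (hh : Integrable h P)
    (hb : ∀ᵐ ω ∂P, ∀ q, |F ω q| ≤ h ω) (h0 : ∀ q, ∫ ω, F ω q ∂P = 0) :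
    ∫ ω, F ω (x ω) ∂P = 0 := by
  set s := fun n ↦ SimpleFunc.nearestPt (TopologicalSpace.denseSeq K) n with hs
  have hFq : ∀ q, Measurable (fun ω ↦ F ω q) := fun q ↦ (measurable_pi_apply q).comp hF
  have hFi : ∀ q, Integrable (fun ω ↦ F ω q) P := fun q ↦
    hh.mono' (hFq q).aestronglyMeasurable (hb.mono fun ω hω ↦ hω q)
  have hind1 : ∀ n q, Measurable (fun p : K ↦ (s n ⁻¹' {q}).indicator (1 : K → ℝ) p) := fun n q ↦
    measurable_one.indicator (SimpleFunc.measurableSet_fiber _ q)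
  have hzero : ∀ n, ∫ ω, F ω (s n (x ω)) ∂P = 0 := by
    intro n
    simp_rw [simpleFunc_eval_eq_sum]
    have hI : ∀ q, IndepFun (fun ω ↦ (s n ⁻¹' {q}).indicator (1 : K → ℝ) (x ω))
        (fun ω ↦ F ω q) P := fun q ↦ hind.comp (hind1 n q) (measurable_pi_apply q)
    have hXi : ∀ q, Integrable (fun ω ↦ (s n ⁻¹' {q}).indicator (1 : K → ℝ) (x ω)) P := by
      intro q
      refine Integrable.of_bound ((hind1 n q).comp hx).aestronglyMeasurable 1
        (ae_of_all _ fun ω ↦ ?_)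
      refine (norm_indicator_le_norm_self _ _).trans ?_
      simp
    have hmul : ∀ q, Integrable
        (fun ω ↦ (s n ⁻¹' {q}).indicator (1 : K → ℝ) (x ω) * F ω q) P := fun q ↦
      (hI q).integrable_mul (hXi q) (hFi q)
    rw [integral_finsetSum _ fun q _ ↦ hmul q]
    refine Finset.sum_eq_zero fun q _ ↦ ?_
    rw [(hI q).integral_fun_mul_eq_mul_integral (hXi q).aestronglyMeasurable
      (hFi q).aestronglyMeasurable, h0 q, mul_zero]
  -- Path continuity and the envelope `h` carry the identity from simple points to `x` by dominated
  -- convergence.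
  have hlim : Tendsto (fun n ↦ ∫ ω, F ω (s n (x ω)) ∂P) atTop (𝓝 (∫ ω, F ω (x ω) ∂P)) := by
    refine tendsto_integral_of_dominated_convergence h (fun n ↦ ?_) hh (fun n ↦ ?_) ?_
    · exact (aemeasurable_eval ((s n).measurable.comp hx) hFq hc).aestronglyMeasurable
    · filter_upwards [hb] with ω hω using hω _
    · filter_upwards [hc] with ω hω
      exact (hω.tendsto _).comp (tendsto_nearestPt_denseSeq (x ω))
  simp_rw [hzero] at hlim
  exact tendsto_nhds_unique hlim tendsto_const_nhds

end Evaluation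

/-! ### An integrable envelope from the sub-Gaussian gradient. -/

section Tail

theorem integrable_of_gaussian_tail {Ω : Type*} [MeasurableSpace Ω] {P : Measure Ω} {X : Ω → ℝ}
    (hX : AEMeasurable X P) (h0 : 0 ≤ᵐ[P] X) {A b : ℝ} (hb : 0 < b)
    (h : ∀ L : ℝ, 0 ≤ L → P {ω | L < X ω} ≤ ENNReal.ofReal (A * Real.exp (-b * L ^ 2))) :
    Integrable X P := by
  refine ⟨hX.aestronglyMeasurable, ?_⟩
  rw [hasFiniteIntegral_iff_ofReal h0, lintegral_eq_lintegral_meas_lt P h0 hX]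
  calc ∫⁻ t in Set.Ioi 0, P {a | t < X a}
      ≤ ∫⁻ t in Set.Ioi 0, ENNReal.ofReal (A * Real.exp (-b * t ^ 2)) :=
        setLIntegral_mono' measurableSet_Ioi fun t ht ↦ h t (le_of_lt ht)
    _ ≤ ∫⁻ t, ENNReal.ofReal (A * Real.exp (-b * t ^ 2)) := setLIntegral_le_lintegral _ _
    _ < ⊤ := ((integrable_exp_neg_mul_sq hb).const_mul A).lintegral_lt_top

theorem norm_le_sum_abs_apply_single {d : ℕ} (A : Pt d →L[ℝ] ℝ) :
    ‖A‖ ≤ ∑ j, |A (EuclideanSpace.single j 1)| := by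
  refine A.opNorm_le_bound (Finset.sum_nonneg fun j _ ↦ abs_nonneg _) fun v ↦ ?_
  have hv : v = ∑ j, v j • EuclideanSpace.single j (1 : ℝ) := by
    simpa using ((EuclideanSpace.basisFun (Fin d) ℝ).sum_repr v).symm
  have hA : A v = ∑ j, v j * A (EuclideanSpace.single j 1) := by
    conv_lhs => rw [hv]
    simp
  rw [hA, Finset.sum_mul]
  refine (norm_sum_le _ _).trans (Finset.sum_le_sum fun j _ ↦ ?_)
  rw [norm_mul, mul_comm, Real.norm_eq_abs (A _)]
  exact mul_le_mul_of_nonneg_left (PiLp.norm_apply_le v j) (abs_nonneg _)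

/-- A random function which is almost surely continuous on `D`, with an integrable bound. -/
structure IsDominated {d : ℕ} (D : Set (Pt d)) {Ω : Type u} [MeasurableSpace Ω] (P : Measure Ω)
    (f : Ω → Pt d → ℝ) : Prop where
  continuous : ∀ᵐ ω ∂P, Continuous (D.domRestrict (f ω))
  exists_bound : ∃ h : Ω → ℝ, Integrable h P ∧ ∀ᵐ ω ∂P, ∀ q : D, |D.domRestrict (f ω) q| ≤ h ω

theorem IsDominated.combine {d : ℕ} {D : Set (Pt d)} {Ω : Type u} [MeasurableSpace Ω]
    {P : Measure Ω} {f g : Ω → Pt d → ℝ} (hf : IsDominated D P f) (hg : IsDominated D P g)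
    (a b : ℝ) : IsDominated D P (fun ω x ↦ a * f ω x + b * g ω x) where
  continuous := by
    filter_upwards [hf.continuous, hg.continuous] with ω h1 h2
    exact (continuous_const.mul h1).add (continuous_const.mul h2)
  exists_bound := by
    obtain ⟨h1, hi1, hb1⟩ := hf.exists_bound
    obtain ⟨h2, hi2, hb2⟩ := hg.exists_bound
    refine ⟨fun ω ↦ |a| * h1 ω + |b| * h2 ω, (hi1.const_mul _).add (hi2.const_mul _), ?_⟩
    filter_upwards [hb1, hb2] with ω h1 h2 q
    refine (abs_add_le _ _).trans ?_
    rw [abs_mul, abs_mul]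
    exact add_le_add (mul_le_mul_of_nonneg_left (h1 q) (abs_nonneg _))
      (mul_le_mul_of_nonneg_left (h2 q) (abs_nonneg _))

/-- By the mean value inequality on the convex set `D`, the oscillation about a base point is at
most the gradient bound times the diameter, so it inherits a Gaussian tail; the value at the base
point is Gaussian, hence integrable. -/
theorem SmoothSample.isDominated {d : ℕ} {D : Set (Pt d)} (hD : IsCompact D) (hDc : Convex ℝ D)
    (hne : D.Nonempty) {k : Pt d → Pt d → ℝ} {a₁ b₁ a₂ b₂ : ℝ} (hb₁ : 0 < b₁)
    {Ω : Type u} [MeasurableSpace Ω] {P : Measure Ω} {f : Ω → Pt d → ℝ}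
    (hf : IsGPSample D k P f) (hs : SmoothSample D a₁ b₁ a₂ b₂ P f) : IsDominated D P f := by
  have : Nonempty D := hne.to_subtype
  have : CompactSpace D := isCompact_iff_compactSpace.1 hD
  have hcont : ∀ᵐ ω ∂P, Continuous (D.domRestrict (f ω)) :=
    hs.contDiffOn.mono fun ω hω ↦ continuousOn_iff_continuous_domRestrict.1 hω.continuousOn
  refine ⟨hcont, ?_⟩
  obtain ⟨p⟩ := ‹Nonempty D›
  set q := TopologicalSpace.denseSeq D
  -- A countable supremum, hence measurable. If unbounded it is 0 by convention, which can happen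
  -- only on the null set of discontinuous paths.
  set N : Ω → ℝ := fun ω ↦ ⨆ n, |f ω (q n) - f ω p| with hN
  -- The added 1 keeps `C` positive when `d` or the diameter is zero.
  set C : ℝ := d * Metric.diam D + 1 with hC
  have hCpos : 0 < C := by positivity
  have hNm : Measurable N := Measurable.iSup fun n ↦
    ((hf.measurable_eval (q n)).sub (hf.measurable_eval p)).abs
  have hNi : Integrable N P := by
    refine integrable_of_gaussian_tail (A := d * max a₁ 0) (b := ((C * b₁) ^ 2)⁻¹)
      hNm.aemeasurable (ae_of_all _ fun ω ↦ Real.iSup_nonneg fun n ↦ abs_nonneg _)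
      (by positivity) fun L hL ↦ ?_
    calc P {ω | L < N ω}
        ≤ P (⋃ j : Fin d, {ω | ∃ x ∈ D, L / C < |partialDeriv D j (f ω) x|}) := by
          -- The derivative events need not be measurable: monotonicity and subadditivity hold for
          -- the outer measure.
          refine measure_mono_ae ?_
          filter_upwards [hs.contDiffOn] with ω hω hlt
          by_contra hnot
          have hall : ∀ j, ∀ x ∈ D, |partialDeriv D j (f ω) x| ≤ L / C := by
            intro j x hx
            by_contra hlt'
            exact hnot (Set.mem_iUnion.2 ⟨j, x, hx, not_le.1 hlt'⟩)
          have hfd : ∀ x ∈ D, ‖fderivWithin ℝ (f ω) D x‖ ≤ d * (L / C) := by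
            intro x hx
            refine (norm_le_sum_abs_apply_single _).trans ?_
            refine (Finset.sum_le_sum fun j _ ↦ hall j x hx).trans ?_
            simp
          have hle : N ω ≤ L := by
            refine ciSup_le fun n ↦ ?_
            have h1 := hDc.norm_image_sub_le_of_norm_fderivWithin_le
              (hω.differentiableOn (by norm_num)) hfd p.2 (q n).2
            have h2 : ‖(q n : Pt d) - p‖ ≤ Metric.diam D := by
              rw [← dist_eq_norm]
              exact Metric.dist_le_diam_of_mem hD.isBounded (q n).2 p.2
            calc |f ω (q n) - f ω p| ≤ d * (L / C) * ‖(q n : Pt d) - p‖ := h1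
              _ ≤ d * (L / C) * Metric.diam D := by gcongr
              _ = L * ((d * Metric.diam D) / C) := by ring
              _ ≤ L * 1 := by
                gcongr
                rw [div_le_one hCpos]
                linarith
              _ = L := mul_one L
          exact absurd hlt (not_lt.2 hle)
      _ ≤ ∑ j : Fin d, P {ω | ∃ x ∈ D, L / C < |partialDeriv D j (f ω) x|} :=
          measure_iUnion_fintype_le _ _
      _ ≤ ∑ j : Fin d, ENNReal.ofReal (max a₁ 0 * Real.exp (-((C * b₁) ^ 2)⁻¹ * L ^ 2)) := by
          refine Finset.sum_le_sum fun j _ ↦ (hs.tail_first j (L / C) (by positivity)).trans ?_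
          have he : -(L / C / b₁) ^ 2 = -((C * b₁) ^ 2)⁻¹ * L ^ 2 := by
            field_simp
          rw [he]
          gcongr
          exact le_max_left _ _
      _ = ENNReal.ofReal (d * max a₁ 0 * Real.exp (-((C * b₁) ^ 2)⁻¹ * L ^ 2)) := by
          rw [Finset.sum_const, Finset.card_univ, Fintype.card_fin, nsmul_eq_mul, mul_assoc,
            ENNReal.ofReal_mul (p := (d : ℝ)) (by positivity), ENNReal.ofReal_natCast]
  refine ⟨fun ω ↦ N ω + |f ω p|, hNi.add (hf.integrable_eval p).abs, ?_⟩
  filter_upwards [hcont] with ω hω x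
  have hc : Continuous fun y : D ↦ |D.domRestrict (f ω) y - f ω p| :=
    (hω.sub continuous_const).abs
  have h1 : |f ω x - f ω p| ≤ N ω :=
    (le_ciSup (isCompact_range hc).bddAbove x).trans_eq (iSup_eq_iSup_denseSeq hc)
  have h2 := abs_add_le (f ω x - f ω p) (f ω p)
  rw [sub_add_cancel] at h2
  exact h2.trans (by gcongr)

end Tail

/-! ### The past σ-algebra and its independence from the next innovation. -/

section Past

/-- Intersections of sets of `m₁` and `m₃` form a π-system generating the join, and on them the
probabilities factor in two stages. -/
theorem indep_sup_left_of_indep_sup {Ω : Type*} {m₁ m₂ m₃ : MeasurableSpace Ω}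
    {mΩ : MeasurableSpace Ω} {P : Measure Ω} [IsProbabilityMeasure P] (h₁ : m₁ ≤ mΩ) (h₂ : m₂ ≤ mΩ)
    (h₃ : m₃ ≤ mΩ) (h : Indep m₁ m₂ P) (h' : Indep (m₁ ⊔ m₂) m₃ P) : Indep (m₁ ⊔ m₃) m₂ P := by
  have hgen : m₁ ⊔ m₃ = MeasurableSpace.generateFrom
      (Set.image2 (· ∩ ·) {s | MeasurableSet[m₁] s} {s | MeasurableSet[m₃] s}) := by
    refine le_antisymm (sup_le ?_ ?_) (MeasurableSpace.generateFrom_le ?_)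
    · intro s hs
      exact MeasurableSpace.measurableSet_generateFrom ⟨s, hs, Set.univ, MeasurableSet.univ, by simp⟩
    · intro s hs
      exact MeasurableSpace.measurableSet_generateFrom ⟨Set.univ, MeasurableSet.univ, s, hs, by simp⟩
    · rintro _ ⟨s, hs, t, ht, rfl⟩
      exact MeasurableSet.inter (le_sup_left (a := m₁) (b := m₃) s hs)
        (le_sup_right (a := m₁) (b := m₃) t ht)
  refine IndepSets.indep (sup_le h₁ h₃) h₂ ?_ (@MeasurableSpace.isPiSystem_measurableSet _ m₂) hgen
    (@MeasurableSpace.generateFrom_measurableSet _ m₂).symm ?_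
  · rintro _ ⟨s, hs, t, ht, rfl⟩ _ ⟨s', hs', t', ht', rfl⟩ -
    exact ⟨s ∩ s', hs.inter hs', t ∩ t', ht.inter ht', by ext; simp; tauto⟩
  · rw [IndepSets_iff]
    rintro _ b ⟨a, ha, c, hc, rfl⟩ hb
    have e1 : MeasurableSet[m₁ ⊔ m₂] a := le_sup_left (a := m₁) (b := m₂) a ha
    have e2 : MeasurableSet[m₁ ⊔ m₂] b := le_sup_right (a := m₁) (b := m₂) b hb
    have hab := (Indep_iff _ _ _).1 h a b ha hb
    have habc := (Indep_iff _ _ _).1 h' (a ∩ b) c (e1.inter e2) hc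
    have hac := (Indep_iff _ _ _).1 h' a c e1 hc
    simp only
    rw [Set.inter_right_comm, habc, hab, hac]
    ring

/-- The earlier innovations are independent of `G t`; the swap lemma then adjoins `m` (all the
noise, future included) and `m'` (the seed) one after the other. -/
theorem indep_iSup_Iio_sup_sup {Ω : Type*} {G : ℕ → MeasurableSpace Ω} {m m' : MeasurableSpace Ω}
    {mΩ : MeasurableSpace Ω} {P : Measure Ω} [IsProbabilityMeasure P] (hG : ∀ i, G i ≤ mΩ)
    (hm : m ≤ mΩ) (hm' : m' ≤ mΩ) (h : iIndep G P) (h₁ : Indep (⨆ i, G i) m P)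
    (h₂ : Indep ((⨆ i, G i) ⊔ m) m' P) (t : ℕ) :
    Indep (((⨆ i ∈ Set.Iio t, G i) ⊔ m) ⊔ m') (G t) P := by
  have hle : (⨆ i ∈ Set.Iio t, G i) ≤ ⨆ i, G i := iSup₂_le_iSup _ _
  have hlt : G t ≤ ⨆ i, G i := le_iSup _ _
  have hpast : (⨆ i ∈ Set.Iio t, G i) ≤ mΩ := iSup₂_le fun i _ ↦ hG i
  have h0 : Indep (⨆ i ∈ Set.Iio t, G i) (G t) P := by
    have := indep_iSup_of_disjoint hG h (S := Set.Iio t) (T := {t}) (by simp)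
    simpa only [Set.mem_singleton_iff, iSup_iSup_eq_left] using this
  refine indep_sup_left_of_indep_sup (sup_le hpast hm) (hG t) hm'
    (indep_sup_left_of_indep_sup hpast (hG t) hm h0 (indep_of_indep_of_le_left h₁ ?_))
    (indep_of_indep_of_le_left h₂ ?_)
  · exact sup_le hle hlt
  · exact sup_le (sup_le_sup_right hle _) (hlt.trans le_sup_left)

theorem measurable_pi_of_forall {Ω ι β : Type*} {m : MeasurableSpace Ω} [MeasurableSpace β]
    {f : Ω → ι → β} (h : ∀ i, Measurable (fun ω ↦ f ω i)) : Measurable f :=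
  measurable_pi_lambda f h

variable {d : ℕ} {D : Set (Pt d)} {Ω : Type u} {S : Type v} [MeasurableSpace S]
  {g : ℕ → Ω → Pt d → ℝ} {z : ℕ → Ω → ℝ} {U : Ω → S}

/-- The information carried by the seed, the noise, and the innovations before time `t`. -/
@[reducible]
def past (D : Set (Pt d)) (g : ℕ → Ω → Pt d → ℝ) (z : ℕ → Ω → ℝ) (U : Ω → S) (t : ℕ) :
    MeasurableSpace Ω :=
  ((⨆ i ∈ Set.Iio t, MeasurableSpace.comap (fun ω ↦ D.domRestrict (g i ω)) inferInstance)
    ⊔ MeasurableSpace.comap (fun ω t ↦ z t ω) inferInstance)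
    ⊔ MeasurableSpace.comap U inferInstance

theorem past_mono {s t : ℕ} (h : s ≤ t) : past D g z U s ≤ past D g z U t :=
  sup_le_sup_right (sup_le_sup_right (biSup_mono fun _ hi ↦ lt_of_lt_of_le hi h) _) _

theorem measurable_past_innovation {i t : ℕ} (h : i < t) :
    Measurable[past D g z U t] (fun ω ↦ D.domRestrict (g i ω)) := by
  rw [measurable_iff_comap_le]
  exact (le_biSup (fun i ↦ MeasurableSpace.comap (fun ω ↦ D.domRestrict (g i ω)) inferInstance)
    (Set.mem_Iio.2 h)).trans (le_sup_left.trans le_sup_left)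

theorem measurable_past_noise (i t : ℕ) : Measurable[past D g z U t] (z i) := by
  have h : Measurable[past D g z U t] (fun ω t ↦ z t ω) := by
    rw [measurable_iff_comap_le]
    exact le_sup_right.trans le_sup_left
  exact (measurable_pi_apply i).comp h

theorem measurable_past_seed (t : ℕ) : Measurable[past D g z U t] U := by
  rw [measurable_iff_comap_le]
  exact le_sup_right

theorem measurable_past_reward (ε : ℝ) {i t : ℕ} (h : i < t) :
    Measurable[past D g z U t]
      (fun ω ↦ D.domRestrict (reward ε (fun j ↦ g j ω) i)) := by
  induction i with
  | zero => exact measurable_past_innovation h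
  | succ i ih =>
    refine measurable_pi_of_forall fun q ↦ ?_
    have h1 : Measurable[past D g z U t] (fun ω ↦ reward ε (fun j ↦ g j ω) i q) :=
      (measurable_pi_apply q).comp (ih (by omega))
    have h2 : Measurable[past D g z U t] (fun ω ↦ g (i + 1) ω q) :=
      (measurable_pi_apply q).comp (measurable_past_innovation h)
    exact (h1.const_mul _).add (h2.const_mul _)

theorem FullInfoAlgorithm.measurable_play (A : FullInfoAlgorithm D S) (ε : ℝ) (t : ℕ) :
    Measurable[past D g z U t] (fun ω ↦ A.play (U ω) (reward ε (fun i ↦ g i ω)) t) := by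
  unfold FullInfoAlgorithm.play
  have h : Measurable[past D g z U t] (fun ω ↦ (U ω, fun i : Fin t ↦
      D.domRestrict (reward ε (fun i ↦ g i ω) i))) :=
    (measurable_past_seed t).prodMk
      (measurable_pi_of_forall fun i ↦ measurable_past_reward ε i.isLt)
  exact (A.measurable_query t).comp h

end Past

/-! ### Stationarity of the rewards and measurability of bandit queries. -/

section Model

variable {d : ℕ} {D : Set (Pt d)} {k : Pt d → Pt d → ℝ} {σ : ℝ≥0}
  {Ω : Type u} [MeasurableSpace Ω] {P : Measure Ω} {S : Type v} [MeasurableSpace S]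
  {g : ℕ → Ω → Pt d → ℝ} {z : ℕ → Ω → ℝ} {U : Ω → S}

theorem IsModel.past_le (hM : IsModel D k σ P g z U) (t : ℕ) :
    past D g z U t ≤ ‹MeasurableSpace Ω› :=
  sup_le (sup_le (iSup₂_le fun i _ ↦ (hM.gp i).measurable.comap_le)
    (measurable_pi_lambda _ hM.measurable_z).comap_le) hM.measurable_U.comap_le

theorem IsModel.indep_past [IsProbabilityMeasure P] (hM : IsModel D k σ P g z U) (t : ℕ) :
    Indep (past D g z U t)
      (MeasurableSpace.comap (fun ω ↦ D.domRestrict (g t ω)) inferInstance) P := by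
  have hz : Measurable (fun ω t ↦ z t ω) := measurable_pi_lambda _ hM.measurable_z
  refine indep_iSup_Iio_sup_sup (fun i ↦ (hM.gp i).measurable.comap_le) hz.comap_le
    hM.measurable_U.comap_le hM.indep_g (indep_of_indep_of_le_left hM.indep_g_z ?_)
    (indep_of_indep_of_le_left hM.indep_U.symm ?_) t
  · refine iSup_le fun i ↦ measurable_iff_comap_le.1 ?_
    exact (measurable_pi_apply i).comp (comap_measurable (fun ω i ↦ D.domRestrict (g i ω)))
  · refine sup_le (iSup_le fun i ↦ measurable_iff_comap_le.1 ?_) (measurable_iff_comap_le.1 ?_)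
    · exact (measurable_pi_apply i).comp (measurable_fst.comp (comap_measurable
        fun ω ↦ ((fun i ↦ D.domRestrict (g i ω) : ℕ → D → ℝ), (fun t ↦ z t ω : ℕ → ℝ))))
    · exact measurable_snd.comp (comap_measurable
        fun ω ↦ ((fun i ↦ D.domRestrict (g i ω) : ℕ → D → ℝ), (fun t ↦ z t ω : ℕ → ℝ)))

/-- The rewards form a stationary sequence: each is a sample of the same Gaussian process. -/
theorem IsModel.isGPSample_reward [IsProbabilityMeasure P] (hM : IsModel D k σ P g z U) {ε : ℝ}
    (h0 : 0 ≤ ε) (h1 : ε ≤ 1) (t : ℕ) :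
    IsGPSample D k P (fun ω ↦ reward ε (fun i ↦ g i ω) t) := by
  induction t with
  | zero => exact hM.gp 0
  | succ t ih =>
    refine ih.combine (hM.gp (t + 1)) ?_ ?_
    · exact indep_of_indep_of_le_left (hM.indep_past (t + 1))
        (measurable_iff_comap_le.1 (measurable_past_reward ε t.lt_succ_self))
    · rw [Real.sq_sqrt (by linarith), Real.sq_sqrt h0]
      ring

theorem isDominated_reward (hg : ∀ i, IsDominated D P (g i)) (ε : ℝ) (t : ℕ) :
    IsDominated D P (fun ω ↦ reward ε (fun i ↦ g i ω) t) := by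
  induction t with
  | zero => exact hg 0
  | succ t ih => exact ih.combine (hg (t + 1)) _ _

/-- An observation evaluates a reward at a random query, which is known to be measurable only after
modification on the null set of discontinuous paths. Strong induction on time replaces each earlier
query and observation by such a version. -/
theorem BanditAlgorithm.exists_measurable_play [Nonempty D] [CompactSpace D]
    (hg : ∀ i, IsDominated D P (g i)) (A : BanditAlgorithm D S) (ε : ℝ) (t : ℕ) :
    ∃ x' : Ω → D, Measurable[past D g z U t] x' ∧
      (fun ω ↦ A.play (U ω) (reward ε (fun i ↦ g i ω)) (fun t ↦ z t ω) t) =ᵐ[P] x' := by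
  induction t using Nat.strong_induction_on with
  | _ t ih =>
  have key : ∀ i : Fin t, ∃ p : Ω → D × ℝ, Measurable[past D g z U t] p ∧
      (fun ω ↦ (A.play (U ω) (reward ε (fun i ↦ g i ω)) (fun t ↦ z t ω) i,
        reward ε (fun i ↦ g i ω) i
          (A.play (U ω) (reward ε (fun i ↦ g i ω)) (fun t ↦ z t ω) i) + z i ω)) =ᵐ[P] p := by
    intro i
    obtain ⟨x', hx', hxx'⟩ := ih i i.isLt
    replace hx' := hx'.mono (past_mono i.isLt.le) le_rfl
    obtain ⟨y, hy, hyF⟩ := @exists_measurable_eval D _ _ _ _ _ Ω (past D g z U t) x' hx'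
      (fun ω ↦ D.domRestrict (reward ε (fun i ↦ g i ω) i))
      fun q ↦ (measurable_pi_apply q).comp (measurable_past_reward ε i.isLt)
    refine ⟨fun ω ↦ (x' ω, y ω + z i ω), hx'.prodMk (hy.add (measurable_past_noise _ _)), ?_⟩
    filter_upwards [hxx', (isDominated_reward hg ε i).continuous] with ω h1 h2
    rw [h1, hyF ω h2]
    rfl
  choose p hp hpp using key
  refine ⟨fun ω ↦ A.query t (U ω, fun i ↦ p i ω),
    (A.measurable_query t).comp ((measurable_past_seed t).prodMk (measurable_pi_of_forall hp)), ?_⟩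
  filter_upwards [ae_all_iff.2 hpp] with ω hω
  rw [BanditAlgorithm.play]
  congr 2
  funext i
  exact hω i

end Model

/-! ### The expected maximum. -/

section Maximum

variable {d : ℕ} {D : Set (Pt d)} {k : Pt d → Pt d → ℝ}
  {Ω : Type u} [MeasurableSpace Ω] {P : Measure Ω} {f g : Ω → Pt d → ℝ}

theorem IsDominated.iSup_ae_eq [Nonempty D] [CompactSpace D] (hf : IsDominated D P f) :
    (fun ω ↦ ⨆ y : D, f ω y)
      =ᵐ[P] fun ω ↦ ⨆ n, D.domRestrict (f ω) (TopologicalSpace.denseSeq D n) :=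
  hf.continuous.mono fun _ hω ↦ iSup_eq_iSup_denseSeq hω

theorem measurable_iSup_denseSeq [Nonempty D] :
    Measurable fun h : D → ℝ ↦ ⨆ n, h (TopologicalSpace.denseSeq D n) :=
  Measurable.iSup fun _ ↦ measurable_pi_apply _

theorem IsDominated.integrable_iSup [Nonempty D] [CompactSpace D] (hf : IsDominated D P f)
    (hm : IsGPSample D k P f) :
    Integrable (fun ω ↦ ⨆ y : D, f ω y) P := by
  obtain ⟨h, hi, hb⟩ := hf.exists_bound
  refine hi.mono' ⟨_, (measurable_iSup_denseSeq.comp hm.measurable).stronglyMeasurable,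
    hf.iSup_ae_eq⟩ ?_
  filter_upwards [hb] with ω hω
  have hbdd : BddAbove (Set.range fun y : D ↦ f ω y) :=
    ⟨h ω, by rintro _ ⟨y, rfl⟩; exact (abs_le.1 (hω y)).2⟩
  obtain ⟨p⟩ := ‹Nonempty D›
  exact abs_le.2 ⟨(abs_le.1 (hω p)).1.trans (le_ciSup hbdd p), ciSup_le fun y ↦ (abs_le.1 (hω y)).2⟩

theorem IsDominated.le_iSup [CompactSpace D] (hf : IsDominated D P f) :
    ∀ᵐ ω ∂P, ∀ x : D, f ω x ≤ ⨆ y : D, f ω y :=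
  hf.continuous.mono fun _ hω x ↦ le_ciSup (isCompact_range hω).bddAbove x

theorem IsDominated.integral_iSup_eq [IsProbabilityMeasure P] [Nonempty D] [CompactSpace D]
    (hf : IsDominated D P f) (hg : IsDominated D P g) (hfm : IsGPSample D k P f)
    (hgm : IsGPSample D k P g) :
    ∫ ω, ⨆ y : D, f ω y ∂P = ∫ ω, ⨆ y : D, g ω y ∂P := by
  rw [integral_congr_ae hf.iSup_ae_eq, integral_congr_ae hg.iSup_ae_eq]
  exact ((hfm.identDistrib hgm).comp measurable_iSup_denseSeq).integral_eq

/-- Twice the maximum dominates f(x) + f(y) + |f(x) - f(y)|, and the first two terms are centred. -/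
theorem IsDominated.le_integral_iSup [IsProbabilityMeasure P] [Nonempty D] [CompactSpace D]
    (hf : IsDominated D P f) (hfm : IsGPSample D k P f) (x y : D) :
    (∫ t, |t| ∂(gaussianReal 0 (k x x - 2 * k x y + k y y).toNNReal)) / 2
      ≤ ∫ ω, ⨆ y : D, f ω y ∂P := by
  have hx := hfm.integrable_eval x
  have hy := hfm.integrable_eval y
  have hxy : Integrable (fun ω ↦ f ω x - f ω y) P := hx.sub hy
  have hxy' : Integrable (fun ω ↦ f ω x + f ω y) P := hx.add hy
  have h1 : (∫ t, |t| ∂(gaussianReal 0 (k x x - 2 * k x y + k y y).toNNReal))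
      = ∫ ω, |f ω x - f ω y| ∂P := by
    rw [← hfm.map_sub x y, integral_map hxy.aemeasurable continuous_abs.aestronglyMeasurable]
  have h2 : ∫ ω, (f ω x + f ω y + |f ω x - f ω y|) ∂P = ∫ ω, |f ω x - f ω y| ∂P := by
    rw [integral_add hxy' hxy.abs, integral_add hx hy, hfm.mean_eq_zero _ x.2,
      hfm.mean_eq_zero _ y.2]
    simp
  have h3 : ∫ ω, (f ω x + f ω y + |f ω x - f ω y|) ∂P ≤ ∫ ω, 2 * (⨆ y : D, f ω y) ∂P := by
    refine integral_mono_ae (hxy'.add hxy.abs)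
      ((hf.integrable_iSup hfm).const_mul 2) ?_
    filter_upwards [hf.le_iSup] with ω hω
    have h1 := hω x
    have h2 := hω y
    rcases abs_cases (f ω x - f ω y) with h | h <;> linarith
  rw [integral_const_mul] at h3
  linarith

theorem IsDominated.integrable_eval_random [Nonempty D] [CompactSpace D]
    (hf : IsDominated D P f) (hfm : IsGPSample D k P f) {x : Ω → D} (hx : Measurable x) :
    Integrable (fun ω ↦ f ω (x ω)) P := by
  obtain ⟨h, hi, hb⟩ := hf.exists_bound
  have := aemeasurable_eval (F := fun ω ↦ D.domRestrict (f ω)) hx hfm.measurable_eval hf.continuous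
  exact hi.mono' this.aestronglyMeasurable (hb.mono fun ω hω ↦ hω _)

end Maximum

/-! ### Loss per step and total regret. -/

section Regret

variable {d : ℕ} {D : Set (Pt d)} {k : Pt d → Pt d → ℝ} {σ : ℝ≥0}
  {Ω : Type u} [MeasurableSpace Ω] {P : Measure Ω} [IsProbabilityMeasure P]
  {S : Type v} [MeasurableSpace S]
  {g : ℕ → Ω → Pt d → ℝ} {z : ℕ → Ω → ℝ} {U : Ω → S}

theorem IsModel.integral_innovation_eval [Nonempty D] [CompactSpace D]
    (hM : IsModel D k σ P g z U) (hg : ∀ i, IsDominated D P (g i)) {t : ℕ} {x : Ω → D}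
    (hx : Measurable[past D g z U t] x) : ∫ ω, g t ω (x ω) ∂P = 0 := by
  obtain ⟨h, hi, hb⟩ := (hg t).exists_bound
  exact integral_eval_eq_zero (F := fun ω ↦ D.domRestrict (g t ω))
    (hx.mono (hM.past_le t) le_rfl) (hM.gp t).measurable
    (indep_of_indep_of_le_left (hM.indep_past t) (measurable_iff_comap_le.1 hx))
    (hg t).continuous hi hb fun q ↦ (hM.gp t).mean_eq_zero q q.2

/-- The expected reward at a point chosen from the past falls short of the expected maximum. -/
theorem IsModel.integral_reward_eval_le [Nonempty D] [CompactSpace D]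
    (hM : IsModel D k σ P g z U) (hg : ∀ i, IsDominated D P (g i)) {ε : ℝ} (h0 : 0 ≤ ε)
    (h1 : ε ≤ 1) {m : ℝ} (hm0 : 0 ≤ m) (hm : m ≤ ∫ ω, ⨆ y : D, g 0 ω y ∂P) {t : ℕ} {x : Ω → D}
    (hx : Measurable[past D g z U t] x) :
    ∫ ω, reward ε (fun i ↦ g i ω) t (x ω) ∂P
      ≤ (∫ ω, ⨆ y : D, reward ε (fun i ↦ g i ω) t y ∂P) - ε / 2 * m := by
  have hx' : Measurable x := hx.mono (hM.past_le t) le_rfl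
  have hgp := hM.isGPSample_reward h0 h1
  have hdom := isDominated_reward (P := P) hg ε
  have hstat : ∀ s, ∫ ω, ⨆ y : D, reward ε (fun i ↦ g i ω) s y ∂P = ∫ ω, ⨆ y : D, g 0 ω y ∂P :=
    fun s ↦ (hdom s).integral_iSup_eq (hg 0) (hgp s) (hM.gp 0)
  rw [hstat t]
  set M := ∫ ω, ⨆ y : D, g 0 ω y ∂P
  cases t with
  | zero =>
    -- At time zero the query earns nothing on average, so all of `M` is lost, and (ε/2) m ≤ m ≤ M.
    simp only [reward]
    rw [hM.integral_innovation_eval hg hx]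
    nlinarith
  | succ t =>
    have hi := (hdom t).integrable_eval_random (hgp t) hx'
    have hj := (hg (t + 1)).integrable_eval_random (hM.gp (t + 1)) hx'
    simp only [reward]
    rw [integral_add (hi.const_mul _) (hj.const_mul _), integral_const_mul, integral_const_mul,
      hM.integral_innovation_eval hg hx, mul_zero, add_zero]
    -- Even full knowledge of the previous reward earns at most its maximum, whose mean is `M` by
    -- stationarity.
    have hle : ∫ ω, reward ε (fun i ↦ g i ω) t (x ω) ∂P ≤ M := by
      rw [← hstat t]
      refine integral_mono_ae hi ((hdom t).integrable_iSup (hgp t)) ?_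
      filter_upwards [(hdom t).le_iSup] with ω hω using hω _
    have hs : Real.sqrt (1 - ε) ≤ 1 - ε / 2 := by
      rw [Real.sqrt_le_left (by linarith)]
      nlinarith [sq_nonneg ε]
    calc Real.sqrt (1 - ε) * ∫ ω, reward ε (fun i ↦ g i ω) t (x ω) ∂P
        ≤ Real.sqrt (1 - ε) * M := by gcongr
      _ ≤ (1 - ε / 2) * M := by
        have : 0 ≤ M := hm0.trans hm
        gcongr
      _ ≤ M - ε / 2 * m := by nlinarith

/-- Every sequence of queries determined, up to null sets, by the past has linear regret. -/
theorem IsModel.regret_bound [Nonempty D] [CompactSpace D]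
    (hM : IsModel D k σ P g z U) (hg : ∀ i, IsDominated D P (g i)) {ε : ℝ} (h0 : 0 ≤ ε)
    (h1 : ε ≤ 1) {m : ℝ} (hm0 : 0 ≤ m) (hm : m ≤ ∫ ω, ⨆ y : D, g 0 ω y ∂P) {x : Ω → ℕ → D}
    (hx : ∀ t, ∃ x' : Ω → D, Measurable[past D g z U t] x' ∧ (fun ω ↦ x ω t) =ᵐ[P] x') (T : ℕ) :
    Integrable (fun ω ↦ cumRegret D (reward ε (fun i ↦ g i ω)) (x ω) T) P ∧
      m / 2 * (T * ε) ≤ ∫ ω, cumRegret D (reward ε (fun i ↦ g i ω)) (x ω) T ∂P := by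
  have hgp := hM.isGPSample_reward h0 h1
  have hdom := isDominated_reward (P := P) hg ε
  choose x' hx' hxx' using hx
  have hev : ∀ t, (fun ω ↦ reward ε (fun i ↦ g i ω) t (x' t ω))
      =ᵐ[P] fun ω ↦ reward ε (fun i ↦ g i ω) t (x ω t) := fun t ↦ by
    filter_upwards [hxx' t] with ω hω
    rw [hω]
  have hsup := fun t ↦ (hdom t).integrable_iSup (hgp t)
  have hi' := fun t ↦ (hdom t).integrable_eval_random (hgp t)
    ((hx' t).mono (hM.past_le t) le_rfl)
  have hi := fun t ↦ (hi' t).congr (hev t)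
  have hterm : ∀ t, ε / 2 * m ≤ ∫ ω, ((⨆ y : D, reward ε (fun i ↦ g i ω) t y)
      - reward ε (fun i ↦ g i ω) t (x ω t)) ∂P := fun t ↦ by
    rw [integral_sub (hsup t) (hi t), ← integral_congr_ae (hev t)]
    linarith [hM.integral_reward_eval_le hg h0 h1 hm0 hm (hx' t)]
  have hreg : ∀ t, Integrable (fun ω ↦ (⨆ y : D, reward ε (fun i ↦ g i ω) t y)
      - reward ε (fun i ↦ g i ω) t (x ω t)) P := fun t ↦ (hsup t).sub (hi t)
  unfold cumRegret
  refine ⟨integrable_finsetSum _ fun t _ ↦ hreg t, ?_⟩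
  rw [integral_finsetSum _ fun t _ ↦ hreg t]
  calc m / 2 * (T * ε) = ∑ t ∈ Finset.range T, ε / 2 * m := by
        rw [Finset.sum_const, Finset.card_range, nsmul_eq_mul]; ring
    _ ≤ _ := Finset.sum_le_sum fun t _ ↦ hterm t

end Regret

end TVGP

theorem theorem1 {d : ℕ} (D : Set (TVGP.Pt d)) (hD : IsCompact D) (hDc : Convex ℝ D)
    (k : TVGP.Pt d → TVGP.Pt d → ℝ)
    (hk : ∃ x ∈ D, ∃ y ∈ D, k x x - 2 * k x y + k y y ≠ 0)
    (a₁ b₁ a₂ b₂ : ℝ) (hb₁ : 0 < b₁) (hb₂ : 0 < b₂) :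
    ∃ c : ℝ, 0 < c ∧
      ∀ (Ω : Type u) [MeasurableSpace Ω] (P : Measure Ω) [IsProbabilityMeasure P]
        (S : Type v) [MeasurableSpace S] (σ : ℝ≥0)
        (g : ℕ → Ω → TVGP.Pt d → ℝ) (z : ℕ → Ω → ℝ) (U : Ω → S),
        TVGP.IsModel D k σ P g z U →
        (∀ i, TVGP.SmoothSample D a₁ b₁ a₂ b₂ P (g i)) →
        ∀ (ε : ℝ), 0 ≤ ε → ε ≤ 1 →
          (∀ (A : TVGP.BanditAlgorithm D S) (T : ℕ),
            let R : Ω → ℝ := fun ω ↦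
              let f := TVGP.reward ε (fun i ↦ g i ω)
              TVGP.cumRegret D f (A.play (U ω) f (fun t ↦ z t ω)) T
            Integrable R P ∧ c * (T * ε) ≤ ∫ ω, R ω ∂P) ∧
          (∀ (A : TVGP.FullInfoAlgorithm D S) (T : ℕ),
            let R : Ω → ℝ := fun ω ↦
              let f := TVGP.reward ε (fun i ↦ g i ω)
              TVGP.cumRegret D f (A.play (U ω) f) T
            Integrable R P ∧ c * (T * ε) ≤ ∫ ω, R ω ∂P) := by
  obtain ⟨x, hx, y, hy, hxy⟩ := hk
  have hne : D.Nonempty := ⟨x, hx⟩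
  have : Nonempty D := hne.to_subtype
  have : CompactSpace D := isCompact_iff_compactSpace.1 hD
  set v : ℝ := k x x - 2 * k x y + k y y with hv
  -- The constant is fixed before any process is given, so `v` is not yet known to be a variance;
  -- the absolute value keeps the parameter nonzero, and `hv0` later removes it.
  set m : ℝ := ∫ t, |t| ∂(gaussianReal 0 (Real.nnabs v)) with hm
  have hmpos : 0 < m := TVGP.integral_abs_gaussianReal_pos (by simpa using hxy)
  -- One half comes from the bound on the expected maximum, the other from √(1-ε) ≤ 1 - ε/2.
  refine ⟨m / 2 / 2, by positivity, ?_⟩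
  intro Ω _ P _ S _ σ g z U hM hs ε h0 h1
  have hg : ∀ i, TVGP.IsDominated D P (g i) :=
    fun i ↦ (hs i).isDominated hD hDc hne hb₁ (hM.gp i)
  have hle : m / 2 ≤ ∫ ω, ⨆ y : D, g 0 ω y ∂P := by
    have h := (hg 0).le_integral_iSup (hM.gp 0) ⟨x, hx⟩ ⟨y, hy⟩
    have hv0 : 0 ≤ v := (hM.gp 0).increment_nonneg ⟨x, hx⟩ ⟨y, hy⟩
    rwa [hm, Real.nnabs_of_nonneg hv0]
  exact ⟨fun A T ↦ hM.regret_bound hg h0 h1 (by positivity) hle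
      (fun t ↦ A.exists_measurable_play hg ε t) T,
    fun A T ↦ hM.regret_bound hg h0 h1 (by positivity) hle
      (fun t ↦ ⟨_, A.measurable_play ε t, ae_eq_rfl⟩) T⟩
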